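/- Let $f:[0,\infty)\to\mathbb R$ be a twice continuously differentiable (one-sided derivatives at $0$), strictly positive function such that $$(f'(x))^2\le f''(x)\,f(x)\qquad\text{for all }x\in[0,\infty),$$ and put $a_n=f(n)$, $n=0,1,2,\dots$. Let $\Omega\subset\mathbb C$ be a domain (non-empty, open, connected) such that the series $$K(z,w)=\sum_{n=0}^\infty a_n z^n\overline{w}^{\,n}$$ converges absolutely for all $z,w\in\Omega$ (for instance $\Omega=\{z\in\mathbb C:|z|^2<R\}$, if the radius of convergence $R$ of $\sum_n a_nt^n$ is positive). Then $K$ is a complete Nevanlinna–Pick kernel on $\Omega$. Here a function $K:\Omega\times\Omega\to\mathbb C$ is called a complete Nevanlinna–Pick kernel if it is a positive definite kernel (that is, all the matrices $(K(z_i,z_j))_{i,j}$ are Hermitian and positive semidefinite) and, with $\mathcal H(K)$ the reproducing kernel Hilbert space with kernel $K$, the following holds for all non-negative integers $m,p,q$, all $w_1,\dots,w_m\in\Omega$ and all $S_1,\dots,S_m\in\mathbb C^{p\times q}$: there is a Schur multiplier $S$, i.e. a function $S:\Omega\to\mathbb C^{p\times q}$ for which multiplication by $S$ is a contraction from $\mathcal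 H(K)^q$ into $\mathcal H(K)^p$, with $S(w_j)=S_j$ for $j=1,\dots,m$, if and only if the block matrix $$\big((I_p-S_jS_\ell^*)\,K(w_j,w_\ell)\big)_{j,\ell=1}^m$$ is Hermitian and positive semidefinite. -/

import Mathlib

open scoped ComplexOrder

/-- A positive definite kernel on `X` (in the sense of reproducing kernels): `K` is Hermitian and
`∑ i, ∑ j, conj (c i) * K (x i) (x j) * c j ≥ 0` for all finite families. -/
def IsPosDefKernel {X : Type*} (K : X → X → ℂ) : Prop :=
  (Matrix.of K).PosSemidef

/-- The scalar kernel `K`, seen as a kernel whose values are operators on the space `ℂ`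
(multiplication by `K z w`), which is the form used for `RKHS.OfKernel`. -/
noncomputable def opKernel {X : Type*} (K : X → X → ℂ) : Matrix X X (ℂ →L[ℂ] ℂ) :=
  Matrix.of fun z w => K z w • (1 : ℂ →L[ℂ] ℂ)

theorem IsPosDefKernel.posSemidef_opKernel {X : Type*} {K : X → X → ℂ} (hK : IsPosDefKernel K) :
    (opKernel K).PosSemidef := by
  have hH : (opKernel K).IsHermitian := by
    ext z w
    have h := hK.isHermitian.apply z w
    simp only [Matrix.of_apply] at h
    simp [opKernel, Matrix.conjTranspose_apply, ← h]
  have t := (RKHS.posSemidef_tfae (K := opKernel K)).out 0 2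
  refine t.mpr ⟨hH, fun v => ?_⟩
  have h := (Complex.le_def.mp (hK.2 v)).1
  have e : (v.sum fun x u => v.sum fun y w => inner ℂ ((opKernel K y x) u) w) =
      star (v.sum fun i xi => v.sum fun j xj => star xi * Matrix.of K i j * xj) := by
    rw [Finsupp.sum_comm]
    simp [opKernel, Finsupp.sum, mul_comm, mul_left_comm]
  rw [e, RCLike.star_def, RCLike.conj_re]
  exact h

/-- The reproducing kernel Hilbert space `ℋ(K)` of functions `X → ℂ` with kernel `K`. -/
abbrev KernelSpace {X : Type*} (K : X → X → ℂ) [Fact (opKernel K).PosSemidef] :=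
  RKHS.OfKernel (opKernel K)

/-- `S : X → ℂ^{p × q}` is a contractive multiplier (Schur multiplier) of the reproducing kernel
Hilbert space `H` of functions `X → ℂ`: the multiplication `F ↦ S F` is a contraction from the
Hilbert space direct sum `H^q` into `H^p`. -/
def IsSchurMultiplier {X : Type*} (H : Type*) [NormedAddCommGroup H] [InnerProductSpace ℂ H]
    [RKHS ℂ H X ℂ] {p q : ℕ} (S : X → Matrix (Fin p) (Fin q) ℂ) : Prop :=
  ∃ M : PiLp 2 (fun _ : Fin q => H) →ₗ[ℂ] PiLp 2 (fun _ : Fin p => H),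
    (∀ F, ‖M F‖ ≤ ‖F‖) ∧ ∀ (F : PiLp 2 (fun _ : Fin q => H)) (z : X) (i : Fin p),
      (M F i) z = ∑ j, S z i j * (F j) z

/-- The block matrix `((I_p - S_j S_ℓ^*) K(w_j, w_ℓ))_{j,ℓ}` of an interpolation problem. -/
def pickMatrix {X : Type*} (K : X → X → ℂ) {m p q : ℕ} (w : Fin m → X)
    (S : Fin m → Matrix (Fin p) (Fin q) ℂ) : Matrix (Fin m × Fin p) (Fin m × Fin p) ℂ :=
  Matrix.of fun a b => ((1 : Matrix (Fin p) (Fin p) ℂ) - S a.1 * (S b.1).conjTranspose) a.2 b.2 * K (w a.1) (w b.1)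

/-- `K` is a complete Nevanlinna-Pick kernel: it is a positive definite kernel and, for matrices of
every size and every finite set of data, nonnegativity of the Pick matrix is necessary and
sufficient for the existence of an interpolating Schur multiplier of `ℋ(K)`. -/
def IsCNPKernel {X : Type*} (K : X → X → ℂ) : Prop :=
  ∃ hK : IsPosDefKernel K,
    haveI : Fact (opKernel K).PosSemidef := ⟨hK.posSemidef_opKernel⟩
    ∀ (m p q : ℕ) (w : Fin m → X) (s : Fin m → Matrix (Fin p) (Fin q) ℂ),
      (∃ S : X → Matrix (Fin p) (Fin q) ℂ,
        IsSchurMultiplier (KernelSpace K) S ∧ ∀ j, S (w j) = s j) ↔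
      (pickMatrix K w s).PosSemidef

theorem norm_linearCombination_sq {ι W : Type*} [NormedAddCommGroup W] [InnerProductSpace ℂ W]
    (x : ι → W) (c : ι →₀ ℂ) :
    ((‖Finsupp.linearCombination ℂ x c‖ ^ 2 : ℝ) : ℂ) =
      ∑ i ∈ c.support, ∑ j ∈ c.support, star (c i) * inner ℂ (x i) (x j) * c j := by
  have h := inner_self_eq_norm_sq_to_K (𝕜 := ℂ) (Finsupp.linearCombination ℂ x c)
  rw [Complex.ofReal_pow]
  refine h.symm.trans ?_
  simp only [Finsupp.linearCombination_apply, Finsupp.sum, sum_inner, inner_sum,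
    inner_smul_left, inner_smul_right, Finset.mul_sum]
  rw [Finset.sum_comm]
  refine Finset.sum_congr rfl fun i _ => Finset.sum_congr rfl fun j _ => ?_
  simp only [RCLike.star_def]
  ring

theorem posSemidef_inner_sub_inner_iff {ι U V : Type*}
    [NormedAddCommGroup U] [InnerProductSpace ℂ U] [NormedAddCommGroup V] [InnerProductSpace ℂ V]
    (u : ι → U) (v : ι → V) :
    (Matrix.of fun i j => inner ℂ (u i) (u j) - inner ℂ (v i) (v j)).PosSemidef ↔
      ∀ c : ι →₀ ℂ, ‖Finsupp.linearCombination ℂ v c‖ ≤ ‖Finsupp.linearCombination ℂ u c‖ := by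
  have key : ∀ c : ι →₀ ℂ, (c.sum fun i xi => c.sum fun j xj => star xi *
      (Matrix.of fun i j => inner ℂ (u i) (u j) - inner ℂ (v i) (v j)) i j * xj) =
      ((‖Finsupp.linearCombination ℂ u c‖ ^ 2 - ‖Finsupp.linearCombination ℂ v c‖ ^ 2 : ℝ) : ℂ) := by
    intro c
    rw [Complex.ofReal_sub, norm_linearCombination_sq, norm_linearCombination_sq]
    simp only [Finsupp.sum, Matrix.of_apply, mul_sub, sub_mul, Finset.sum_sub_distrib]
  constructor
  · intro h c
    have := h.2 c
    rw [key, Complex.zero_le_real, sub_nonneg] at this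
    exact (sq_le_sq₀ (norm_nonneg _) (norm_nonneg _)).mp this
  · intro h
    refine ⟨?_, fun c => ?_⟩
    · ext i j
      simp [Matrix.conjTranspose_apply]
    · rw [key, Complex.zero_le_real, sub_nonneg]
      exact (sq_le_sq₀ (norm_nonneg _) (norm_nonneg _)).mpr (h c)

theorem posSemidef_inner_sub_inner_iff_exists_contraction {ι U V : Type*}
    [NormedAddCommGroup U] [InnerProductSpace ℂ U] [CompleteSpace U]
    [NormedAddCommGroup V] [InnerProductSpace ℂ V] [CompleteSpace V]
    (u : ι → U) (v : ι → V) :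
    (Matrix.of fun i j => inner ℂ (u i) (u j) - inner ℂ (v i) (v j)).PosSemidef ↔
      ∃ T : U →L[ℂ] V, ‖T‖ ≤ 1 ∧ ∀ i, T (u i) = v i := by
  rw [posSemidef_inner_sub_inner_iff]
  constructor
  · intro h
    set L := Finsupp.linearCombination ℂ u with hL
    set R := Finsupp.linearCombination ℂ v with hR
    set W := (LinearMap.range L).topologicalClosure with hW
    have hmem : ∀ c, L c ∈ W := fun c => Submodule.le_topologicalClosure _ ⟨c, rfl⟩
    set e : (ι →₀ ℂ) →ₗ[ℂ] W := L.codRestrict W hmem with he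
    have hdense : DenseRange e := by
      intro x
      rw [closure_subtype]
      have : ((↑) '' Set.range e : Set U) = (LinearMap.range L : Set U) := by
        ext y
        simp [he]
      rw [this]
      exact x.2
    have hW : CompleteSpace W := (Submodule.isClosed_topologicalClosure _).completeSpace_coe
    have hn : ∀ c, ‖R c‖ ≤ 1 * ‖e c‖ := fun c => by
      rw [one_mul]
      exact h c
    refine ⟨(R.extendOfNorm e).comp W.orthogonalProjectionOnto, ?_, fun i => ?_⟩
    · refine ContinuousLinearMap.opNorm_le_bound _ zero_le_one fun x => ?_
      refine (LinearMap.norm_extendOfNorm_apply_le hdense 1 hn _).trans ?_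
      rw [one_mul, one_mul]
      exact W.norm_orthogonalProjectionOnto_apply_le x
    · have h1 : u i = (e (Finsupp.single i 1) : U) := by simp [he, hL]
      rw [ContinuousLinearMap.comp_apply, h1, Submodule.orthogonalProjectionOnto_mem_subspace_eq_self,
        LinearMap.extendOfNorm_eq hdense ⟨1, hn⟩]
      simp [hR]
  · rintro ⟨T, hT, h⟩ c
    have : Finsupp.linearCombination ℂ v c = T (Finsupp.linearCombination ℂ u c) := by
      simp [Finsupp.linearCombination_apply, Finsupp.sum, h]
    rw [this]
    exact (T.le_of_opNorm_le hT _).trans_eq (one_mul _)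

theorem posSemidef_of_inner {ι U : Type*} [NormedAddCommGroup U] [InnerProductSpace ℂ U]
    (u : ι → U) : (Matrix.of fun i j => inner ℂ (u i) (u j)).PosSemidef := by
  have := (posSemidef_inner_sub_inner_iff u (fun _ => (0 : ℂ))).mpr fun c => by
    simp [Finsupp.linearCombination_apply]
  simpa using this

theorem exists_eq_inner_of_posSemidef {ι : Type*} [Fintype ι] {A : Matrix ι ι ℂ}
    (hA : A.PosSemidef) : ∃ g : ι → EuclideanSpace ℂ ι, ∀ i j, A i j = inner ℂ (g i) (g j) := by
  classical
  open scoped MatrixOrder in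
  obtain ⟨B, rfl⟩ := CStarAlgebra.nonneg_iff_eq_star_mul_self.mp hA.nonneg
  refine ⟨fun i => WithLp.toLp 2 fun k => B k i, fun i j => ?_⟩
  simp [Matrix.star_eq_conjTranspose, Matrix.mul_apply, PiLp.inner_apply, mul_comm]

/-- The kernel `(I - S(z) S(w)^*) K(z, w)` with matrix values, as a scalar kernel. -/
noncomputable def deBrangesRovnyakKernel {X : Type*} (K : X → X → ℂ) {p q : ℕ}
    (S : X → Matrix (Fin p) (Fin q) ℂ) : Matrix (X × Fin p) (X × Fin p) ℂ :=
  Matrix.of fun a b =>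
    ((1 : Matrix (Fin p) (Fin p) ℂ) - S a.1 * (S b.1).conjTranspose) a.2 b.2 * K a.1 b.1

theorem isSchurMultiplier_iff_posSemidef {X H : Type*} [NormedAddCommGroup H]
    [InnerProductSpace ℂ H] [CompleteSpace H] [RKHS ℂ H X ℂ] {K : X → X → ℂ}
    (hK : RKHS.kernel H = opKernel K) {p q : ℕ} (S : X → Matrix (Fin p) (Fin q) ℂ) :
    IsSchurMultiplier H S ↔ (deBrangesRovnyakKernel K S).PosSemidef := by
  classical
  set k : X → H := fun x => RKHS.kerFun H x 1 with hk
  have hkk : ∀ x y, inner ℂ (k x) (k y) = K x y := by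
    intro x y
    rw [hk, RKHS.kerFun_inner, RKHS.kerFun_apply, hK]
    simp [opKernel]
  have hkf : ∀ x (F : H), inner ℂ (k x) F = F x := by
    intro x F
    simp [hk, RKHS.kerFun_inner]
  set u : X × Fin p → PiLp 2 (fun _ : Fin p => H) :=
    fun a => WithLp.toLp 2 (Pi.single a.2 (k a.1)) with hu
  set v : X × Fin p → PiLp 2 (fun _ : Fin q => H) :=
    fun a => WithLp.toLp 2 (fun j => star (S a.1 a.2 j) • k a.1) with hv
  have huF : ∀ a (F : PiLp 2 (fun _ : Fin p => H)), inner ℂ (u a) F = (F a.2) a.1 := by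
    intro a F
    rw [PiLp.inner_apply, Finset.sum_eq_single a.2]
    · simp [hu, hkf]
    · intro i _ hi
      simp [hu, hi]
    · simp
  have hvF : ∀ a (F : PiLp 2 (fun _ : Fin q => H)),
      inner ℂ (v a) F = ∑ j, S a.1 a.2 j * (F j) a.1 := by
    intro a F
    rw [PiLp.inner_apply]
    simp [hv, inner_smul_left, hkf]
  have hmat : deBrangesRovnyakKernel K S =
      Matrix.of fun a b => inner ℂ (u a) (u b) - inner ℂ (v a) (v b) := by
    ext ⟨x, i⟩ ⟨y, j⟩
    rw [Matrix.of_apply, huF, hvF]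
    have h1 : ∀ x y, (k y) x = K x y := fun x y => by rw [← hkk, hkf]
    by_cases hab : i = j
    · subst hab
      simp [deBrangesRovnyakKernel, hu, hv, h1, sub_mul, Matrix.mul_apply, Finset.sum_mul,
        mul_assoc]
    · simp [deBrangesRovnyakKernel, hu, hv, hab, h1, sub_mul, Matrix.mul_apply, Finset.sum_mul,
        mul_assoc]
  rw [hmat, posSemidef_inner_sub_inner_iff_exists_contraction]
  constructor
  · rintro ⟨M, hM, hMS⟩
    set M' := M.mkContinuous 1 (fun F => by simpa using hM F) with hM'
    refine ⟨M'.adjoint, ?_, fun a => ?_⟩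
    · rw [LinearIsometryEquiv.norm_map]
      exact M.mkContinuous_norm_le zero_le_one _
    · refine ext_inner_right ℂ fun F => ?_
      rw [ContinuousLinearMap.adjoint_inner_left, huF, hvF]
      exact hMS F a.1 a.2
  · rintro ⟨T, hT, h⟩
    refine ⟨T.adjoint.toLinearMap, fun F => ?_, fun F z i => ?_⟩
    · have : ‖T.adjoint‖ ≤ 1 := by rwa [LinearIsometryEquiv.norm_map]
      exact (T.adjoint.le_of_opNorm_le this F).trans_eq (one_mul _)
    · have := huF (z, i) (T.adjoint F)
      rw [ContinuousLinearMap.adjoint_inner_right, h, hvF] at this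
      exact this.symm

/-- The tensor `g ⊗ x` in the Hilbert space direct sum `E^I = ℂ^I ⊗ E`. -/
noncomputable def piTensor {I E : Type*} [Fintype I] [NormedAddCommGroup E] [InnerProductSpace ℂ E]
    (x : E) (g : EuclideanSpace ℂ I) : PiLp 2 (fun _ : I => E) :=
  WithLp.toLp 2 fun i => g i • x

section

variable {I E : Type*} [Fintype I] [NormedAddCommGroup E] [InnerProductSpace ℂ E]

theorem inner_piTensor (x y : E) (g h : EuclideanSpace ℂ I) :
    inner ℂ (piTensor x g) (piTensor y h) = inner ℂ g h * inner ℂ x y := by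
  simp only [piTensor, PiLp.inner_apply, inner_smul_left, inner_smul_right, Finset.sum_mul]
  refine Finset.sum_congr rfl fun i _ => ?_
  simp only [RCLike.inner_apply]
  ring

theorem norm_piTensor (x : E) (g : EuclideanSpace ℂ I) : ‖piTensor x g‖ = ‖x‖ * ‖g‖ := by
  have h := inner_piTensor x x g g
  simp only [inner_self_eq_norm_sq_to_K, ← mul_pow] at h
  have h' : ‖piTensor x g‖ ^ 2 = (‖x‖ * ‖g‖) ^ 2 := by
    rw [mul_comm ‖x‖]
    exact_mod_cast h
  exact (sq_eq_sq₀ (norm_nonneg _) (by positivity)).mp h'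

theorem piTensor_sub (x : E) (g h : EuclideanSpace ℂ I) :
    piTensor x (g - h) = piTensor x g - piTensor x h := by
  ext i
  simp [piTensor, sub_smul]

end

/-- A contraction `T`, seen as a colligation with state space `G`, has a unique internal state `g`
for every input `ξ` and every parameter `x` with `‖x‖ < 1`. -/
theorem existsUnique_state {I E P Q : Type*} [Fintype I] [NormedAddCommGroup E]
    [InnerProductSpace ℂ E] [NormedAddCommGroup P] [InnerProductSpace ℂ P]
    [NormedAddCommGroup Q] [InnerProductSpace ℂ Q]
    {T : WithLp 2 (P × PiLp 2 (fun _ : I => E)) →L[ℂ] WithLp 2 (Q × EuclideanSpace ℂ I)}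
    (hT : ‖T‖ ≤ 1) {x : E} (hx : ‖x‖ < 1) (ξ : P) :
    ∃! g : EuclideanSpace ℂ I, (T (WithLp.toLp 2 (ξ, piTensor x g))).snd = g := by
  have hc : ContractingWith ‖x‖₊ fun g : EuclideanSpace ℂ I =>
      (T (WithLp.toLp 2 (ξ, piTensor x g))).snd := by
    refine ⟨hx, LipschitzWith.of_dist_le_mul fun g h => ?_⟩
    rw [dist_eq_norm, dist_eq_norm, ← WithLp.sub_snd, ← map_sub, ← WithLp.toLp_sub, Prod.mk_sub_mk,
      sub_self, ← piTensor_sub, coe_nnnorm, ← norm_piTensor]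
    refine (WithLp.norm_snd_le _ _).trans ((T.le_of_opNorm_le hT _).trans_eq ?_)
    rw [one_mul, WithLp.norm_toLp_snd]
  refine ⟨hc.fixedPoint, hc.fixedPoint_isFixedPt, fun g hg => hc.fixedPoint_unique hg⟩

theorem exists_interpolant_of_mul_one_sub_inner {X E : Type*} [NormedAddCommGroup E]
    [InnerProductSpace ℂ E] [CompleteSpace E] {K : X → X → ℂ} (hK : IsPosDefKernel K)
    (e : X → E) (he : ∀ x, ‖e x‖ < 1) {c : ℝ} (hc : 0 < c)
    (hKe : ∀ x y, K x y * (1 - inner ℂ (e x) (e y)) = c) {m p q : ℕ} (w : Fin m → X)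
    (s : Fin m → Matrix (Fin p) (Fin q) ℂ) (hs : (pickMatrix K w s).PosSemidef) :
    ∃ S : X → Matrix (Fin p) (Fin q) ℂ,
      (deBrangesRovnyakKernel K S).PosSemidef ∧ ∀ j, S (w j) = s j := by
  classical
  have hcc : (c : ℂ) ≠ 0 := by exact_mod_cast hc.ne'
  obtain ⟨g, hg⟩ := exists_eq_inner_of_posSemidef (hs.smul (inv_nonneg.mpr hc.le))
  set ε : Fin p → EuclideanSpace ℂ (Fin p) := fun i => EuclideanSpace.single i 1 with hε
  have hεε : ∀ i k, inner ℂ (ε i) (ε k) = (1 : Matrix (Fin p) (Fin p) ℂ) i k := by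
    intro i k
    simp [hε, Matrix.one_apply, EuclideanSpace.inner_single_left]
  set row : Matrix (Fin p) (Fin q) ℂ → Fin p → EuclideanSpace ℂ (Fin q) :=
    fun A i => WithLp.toLp 2 fun l => star (A i l) with hrow
  have hrr : ∀ A B i k, inner ℂ (row A i) (row B k) = (A * B.conjTranspose) i k := by
    intro A B i k
    simp [hrow, PiLp.inner_apply, Matrix.mul_apply, mul_comm]
  set u : Fin m × Fin p → WithLp 2 (EuclideanSpace ℂ (Fin p) × PiLp 2 fun _ : Fin m × Fin p => E) :=
    fun a => WithLp.toLp 2 (ε a.2, piTensor (e (w a.1)) (g a)) with hu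
  set v : Fin m × Fin p → WithLp 2 (EuclideanSpace ℂ (Fin q) × EuclideanSpace ℂ (Fin m × Fin p)) :=
    fun a => WithLp.toLp 2 (row (s a.1) a.2, g a) with hv
  have huv : (Matrix.of fun a b => inner ℂ (u a) (u b) - inner ℂ (v a) (v b)).PosSemidef := by
    convert Matrix.PosSemidef.zero using 1
    ext a b
    have h1 := hKe (w a.1) (w b.1)
    have h2 := hg a b
    simp only [pickMatrix, Matrix.smul_apply, Matrix.of_apply, Matrix.sub_apply,
      Complex.real_smul, Complex.ofReal_inv] at h2
    simp only [hu, hv, Matrix.of_apply, WithLp.prod_inner_apply, inner_piTensor, hεε, hrr,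
      Matrix.zero_apply, ← h2]
    field_simp
    linear_combination (-(1 : Matrix (Fin p) (Fin p) ℂ) a.2 b.2 +
      (s a.1 * (s b.1).conjTranspose) a.2 b.2) * h1
  obtain ⟨T, hT, hTuv⟩ := (posSemidef_inner_sub_inner_iff_exists_contraction u v).mp huv
  choose h hh hh' using fun a : X × Fin p => existsUnique_state hT (he a.1) (ε a.2)
  have hhg : ∀ a, g a = h (w a.1, a.2) := by
    intro a
    refine hh' _ _ ?_
    have := hTuv a
    simp only [hu, hv] at this
    simp [this]
  set U : X × Fin p → WithLp 2 (EuclideanSpace ℂ (Fin p) × PiLp 2 fun _ : Fin m × Fin p => E) :=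
    fun a => WithLp.toLp 2 (ε a.2, piTensor (e a.1) (h a)) with hU
  set S : X → Matrix (Fin p) (Fin q) ℂ := fun x => Matrix.of fun i l => star ((T (U (x, i))).fst l)
    with hS
  have hTU : ∀ a, T (U a) = WithLp.toLp 2 (row (S a.1) a.2, h a) := by
    intro a
    refine WithLp.ofLp_injective 2 (Prod.ext ?_ (hh a))
    ext l
    simp [hrow, hS]
  refine ⟨S, ?_, fun j => ?_⟩
  · have hP := (posSemidef_inner_sub_inner_iff_exists_contraction U (fun a => T (U a))).mpr
      ⟨T, hT, fun _ => rfl⟩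
    have hK' : (Matrix.of fun a b : X × Fin p => K a.1 b.1).PosSemidef := hK.submatrix Prod.fst
    refine Eq.subst (motive := Matrix.PosSemidef) (Matrix.ext fun a b => ?_)
      ((hP.hadamard hK').add ((posSemidef_of_inner h).smul hc.le))
    have h1 := hKe a.1 b.1
    simp only [deBrangesRovnyakKernel, hTU, Matrix.of_apply, Matrix.sub_apply, Matrix.add_apply,
      Matrix.hadamard_apply, Matrix.smul_apply, Complex.real_smul, WithLp.prod_inner_apply, hrr]
    simp only [hU, inner_piTensor, hεε]
    linear_combination -inner ℂ (h a) (h b) * h1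
  · ext i l
    have h1 := hTU (w j, i)
    have h2 := hTuv (j, i)
    simp only [hU, hu, hv, ← hhg (j, i)] at h1 h2
    rw [h2] at h1
    have h3 := congrArg (fun z => star (z.fst l)) h1
    simpa [hrow] using h3.symm

/-- A positive definite kernel `K` with `1 - c / K` positive definite, for some `c > 0`, is a
complete Nevanlinna-Pick kernel. -/
theorem isCNPKernel_of_mul_one_sub_inner {X E : Type*} [NormedAddCommGroup E]
    [InnerProductSpace ℂ E] [CompleteSpace E] {K : X → X → ℂ} (hK : IsPosDefKernel K)
    (e : X → E) (he : ∀ x, ‖e x‖ < 1) {c : ℝ} (hc : 0 < c)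
    (hKe : ∀ x y, K x y * (1 - inner ℂ (e x) (e y)) = c) : IsCNPKernel K := by
  refine ⟨hK, ?_⟩
  have : Fact (opKernel K).PosSemidef := ⟨hK.posSemidef_opKernel⟩
  intro m p q w s
  have hker : RKHS.kernel (KernelSpace K) = opKernel K := RKHS.OfKernel.kernel_ofKernel
  constructor
  · rintro ⟨S, hS, hSw⟩
    have := ((isSchurMultiplier_iff_posSemidef hker S).mp hS).submatrix
      fun a : Fin m × Fin p => (w a.1, a.2)
    convert this using 1
    ext a b
    simp [pickMatrix, deBrangesRovnyakKernel, hSw]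
  · intro hs
    obtain ⟨S, hS, hSw⟩ := exists_interpolant_of_mul_one_sub_inner hK e he hc hKe w s hs
    exact ⟨S, (isSchurMultiplier_iff_posSemidef hker S).mpr hS, hSw⟩

theorem sq_succ_le_mul_of_log_convex {f : ℝ → ℝ} (hf : ContDiffOn ℝ 2 f (Set.Ici 0))
    (hpos : ∀ x ∈ Set.Ici (0 : ℝ), 0 < f x)
    (hlog : ∀ x ∈ Set.Ici (0 : ℝ),
      (derivWithin f (Set.Ici 0) x) ^ 2 ≤ iteratedDerivWithin 2 f (Set.Ici 0) x * f x) (n : ℕ) :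
    f (n + 1 : ℕ) ^ 2 ≤ f n * f (n + 2 : ℕ) := by
  have hu : UniqueDiffOn ℝ (Set.Ici (0 : ℝ)) := uniqueDiffOn_Ici 0
  set f1 := derivWithin f (Set.Ici 0) with hf1
  have hd : ∀ x, 0 < x → HasDerivAt f (f1 x) x := fun x hx =>
    ((hf.differentiableOn (by norm_num)) x hx.le).hasDerivWithinAt.hasDerivAt (Ici_mem_nhds hx)
  have hf1c : ContDiffOn ℝ 1 f1 (Set.Ici 0) := hf.derivWithin hu (by norm_num)
  have hd1 : ∀ x, 0 < x → HasDerivAt f1 (iteratedDerivWithin 2 f (Set.Ici 0) x) x := by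
    intro x hx
    have h := ((hf1c.differentiableOn (by norm_num)) x hx.le).hasDerivWithinAt.hasDerivAt
      (Ici_mem_nhds hx)
    have e : iteratedDerivWithin 2 f (Set.Ici 0) x = derivWithin f1 (Set.Ici 0) x := by
      rw [iteratedDerivWithin_succ, iteratedDerivWithin_one]
    rwa [e]
  have hlogd : ∀ x, 0 < x → HasDerivAt (fun y => Real.log (f y)) (f1 x / f x) x := fun x hx =>
    (hd x hx).log (hpos x hx.le).ne'
  have hq : ∀ x, 0 < x → HasDerivAt (fun y => f1 y / f y)
      ((iteratedDerivWithin 2 f (Set.Ici 0) x * f x - f1 x * f1 x) / f x ^ 2) x := fun x hx =>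
    (hd1 x hx).div (hd x hx) (hpos x hx.le).ne'
  have hmono : MonotoneOn (fun y => f1 y / f y) (Set.Ioi 0) := by
    refine monotoneOn_of_deriv_nonneg (convex_Ioi 0)
      (fun x hx => (hq x hx).continuousAt.continuousWithinAt)
      (fun x hx => (hq x (by simpa using hx)).differentiableAt.differentiableWithinAt)
      fun x hx => ?_
    have hx : 0 < x := by simpa using hx
    rw [(hq x hx).deriv, ← sq]
    exact div_nonneg (sub_nonneg.mpr (hlog x hx.le)) (sq_nonneg _)
  have hconv : ConvexOn ℝ (Set.Ici 0) (fun y => Real.log (f y)) := by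
    refine MonotoneOn.convexOn_of_deriv (convex_Ici 0)
      (hf.continuousOn.log fun x hx => (hpos x hx).ne') ?_ ?_
    · rw [interior_Ici]
      exact fun x hx => (hlogd x hx).differentiableAt.differentiableWithinAt
    · rw [interior_Ici]
      exact hmono.congr fun x hx => (hlogd x hx).deriv.symm
  have h0 : (0 : ℝ) ≤ n := n.cast_nonneg
  have hm := hconv.2 (show (n : ℝ) ∈ Set.Ici 0 from h0)
    (show ((n + 2 : ℕ) : ℝ) ∈ Set.Ici 0 from Set.mem_Ici.mpr (Nat.cast_nonneg _))
    (show (0 : ℝ) ≤ 1 / 2 by norm_num) (show (0 : ℝ) ≤ 1 / 2 by norm_num) (by norm_num)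
  have e : (1 / 2 : ℝ) • (n : ℝ) + (1 / 2 : ℝ) • ((n + 2 : ℕ) : ℝ) = ((n + 1 : ℕ) : ℝ) := by
    push_cast
    simp only [smul_eq_mul]
    ring
  rw [e] at hm
  have p0 := hpos n h0
  have p1 := hpos (n + 1 : ℕ) (Set.mem_Ici.mpr (Nat.cast_nonneg _))
  have p2 := hpos (n + 2 : ℕ) (Set.mem_Ici.mpr (Nat.cast_nonneg _))
  rw [← Real.log_le_log_iff (by positivity) (by positivity), Real.log_pow,
    Real.log_mul p0.ne' p2.ne']
  simp only [smul_eq_mul] at hm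
  push_cast at hm ⊢
  linarith

/-- Kaluza's lemma: the reciprocal of a power series with positive log-convex coefficients has
nonpositive coefficients, apart from the constant one. -/
theorem exists_kaluza_coeff {a : ℕ → ℝ} (ha : ∀ n, 0 < a n)
    (hlc : ∀ n, a (n + 1) ^ 2 ≤ a n * a (n + 2)) :
    ∃ b : ℕ → ℝ, (∀ n, 0 ≤ b n) ∧ (∀ n, a 0 * b n ≤ a n) ∧
      ∀ n, ∑ kl ∈ Finset.HasAntidiagonal.antidiagonal n, ((if kl.1 = 0 then 1 else 0) - b kl.1) * a kl.2 =
        if n = 0 then a 0 else 0 := by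
  have hratio : Monotone fun n => a (n + 1) / a n := by
    refine monotone_nat_of_le_succ fun n => ?_
    rw [div_le_div_iff₀ (ha _) (ha _), ← sq, mul_comm]
    exact hlc n
  set A : PowerSeries ℝ := PowerSeries.mk a with hA
  set D : PowerSeries ℝ := PowerSeries.C (a 0) * A⁻¹ with hD
  set d : ℕ → ℝ := fun n => PowerSeries.coeff n D with hd
  have hA0 : PowerSeries.constantCoeff A ≠ 0 := by
    simpa [hA, ← PowerSeries.coeff_zero_eq_constantCoeff_apply] using (ha 0).ne'
  have hDA : D * A = PowerSeries.C (a 0) := by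
    rw [hD, mul_assoc, PowerSeries.inv_mul_cancel A hA0, mul_one]
  have hconv : ∀ n, ∑ kl ∈ Finset.HasAntidiagonal.antidiagonal n, d kl.1 * a kl.2 = if n = 0 then a 0 else 0 := by
    intro n
    have := congrArg (PowerSeries.coeff n) hDA
    rw [PowerSeries.coeff_mul, PowerSeries.coeff_C] at this
    simpa [hA] using this
  have hrange : ∀ n, ∑ k ∈ Finset.range (n + 1), d k * a (n - k) = if n = 0 then a 0 else 0 :=
    fun n => by
      rw [← hconv n, Finset.Nat.sum_antidiagonal_eq_sum_range_succ (fun k l => d k * a l)]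
  have hd0 : d 0 = 1 := by
    have := hrange 0
    simp only [zero_add, Finset.range_one, Finset.sum_singleton, if_true, Nat.sub_zero] at this
    exact (mul_eq_right₀ (ha 0).ne').mp this
  have hneg : ∀ n, d (n + 1) ≤ 0 := by
    intro n
    induction n using Nat.strong_induction_on with
    | _ n ih =>
      have h1 := hrange (n + 1)
      rw [Finset.sum_range_succ, Nat.sub_self, if_neg n.succ_ne_zero] at h1
      have h2 : a (n + 1) / a n * ∑ k ∈ Finset.range (n + 1), d k * a (n - k) ≤
          ∑ k ∈ Finset.range (n + 1), d k * a (n + 1 - k) := by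
        rw [Finset.mul_sum]
        refine Finset.sum_le_sum fun k hk => ?_
        rcases k with _ | k
        · simp [hd0, div_mul_cancel₀ _ (ha n).ne']
        · have hk' : k < n := by simpa using hk
          have hr := hratio (show n - (k + 1) ≤ n by omega)
          simp only at hr
          rw [div_le_iff₀ (ha _)] at hr
          have e : n + 1 - (k + 1) = n - (k + 1) + 1 := by omega
          rw [e]
          nlinarith [ih k hk']
      have h3 : 0 ≤ a (n + 1) / a n * ∑ k ∈ Finset.range (n + 1), d k * a (n - k) := by
        rw [hrange]
        have := ha 0
        have := ha n
        have := ha (n + 1)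
        split_ifs <;> positivity
      have h4 : d (n + 1) * a 0 ≤ 0 := by linarith
      exact nonpos_of_mul_nonpos_left h4 (ha 0)
  have hbound : ∀ n, a 0 * -d (n + 1) ≤ a (n + 1) := by
    intro n
    have h1 := hrange (n + 1)
    rw [Finset.sum_range_succ, Finset.sum_range_succ', Nat.sub_self, Nat.sub_zero, hd0,
      if_neg n.succ_ne_zero] at h1
    have h2 : ∑ k ∈ Finset.range n, d (k + 1) * a (n + 1 - (k + 1)) ≤ 0 :=
      Finset.sum_nonpos fun k _ => mul_nonpos_of_nonpos_of_nonneg (hneg k) (ha _).le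
    linarith
  refine ⟨fun n => (if n = 0 then 1 else 0) - d n, ?_, ?_, fun n => ?_⟩
  · rintro (_ | n)
    · simp [hd0]
    · simpa using hneg n
  · rintro (_ | n)
    · simpa [hd0] using (ha 0).le
    · simpa using hbound n
  · simpa using hconv n

theorem exists_lp_inner_eq_tsum {b : ℕ → ℝ} (hb : ∀ n, 0 ≤ b n) {Ω : Set ℂ}
    (hs : ∀ z ∈ Ω, Summable fun n => b n * ‖z‖ ^ (2 * n)) :
    ∃ φ : Ω → lp (fun _ : ℕ => ℂ) 2, ∀ z w : Ω, inner ℂ (φ z) (φ w) =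
      ∑' n : ℕ, (b n : ℂ) * ((z : ℂ) ^ n * (starRingEnd ℂ (w : ℂ)) ^ n) := by
  have hmem : ∀ z : Ω, Memℓp (fun n : ℕ => (√(b n) : ℂ) * (starRingEnd ℂ (z : ℂ)) ^ n) 2 := by
    intro z
    rw [memℓp_gen_iff (by norm_num)]
    refine (hs z z.2).congr fun n => ?_
    have : (2 : ENNReal).toReal = ((2 : ℕ) : ℝ) := by norm_num
    rw [this, Real.rpow_natCast, norm_mul, mul_pow, norm_pow, RCLike.norm_conj, Complex.norm_real,
      Real.norm_eq_abs, sq_abs, Real.sq_sqrt (hb n)]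
    ring
  refine ⟨fun z => ⟨_, hmem z⟩, fun z w => ?_⟩
  rw [lp.inner_eq_tsum]
  refine tsum_congr fun n => ?_
  have : (b n : ℂ) = (√(b n) : ℂ) * (√(b n) : ℂ) := by
    rw [← Complex.ofReal_mul, Real.mul_self_sqrt (hb n)]
  simp only [RCLike.inner_apply, map_mul, map_pow, Complex.conj_conj, Complex.conj_ofReal]
  rw [this]
  ring

theorem tsum_mul_one_sub_tsum_eq {a b : ℕ → ℝ}
    (hconv : ∀ n, ∑ kl ∈ Finset.HasAntidiagonal.antidiagonal n, ((if kl.1 = 0 then 1 else 0) - b kl.1) * a kl.2 =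
        if n = 0 then a 0 else 0) {t : ℂ}
    (ha : Summable fun n => (a n : ℂ) * t ^ n) (hb : Summable fun n => (b n : ℂ) * t ^ n) :
    (∑' n, (a n : ℂ) * t ^ n) * (1 - ∑' n, (b n : ℂ) * t ^ n) = a 0 := by
  have h1 : HasSum (fun n : ℕ => if n = 0 then (1 : ℂ) else 0) 1 := hasSum_ite_eq 0 1
  have hd := h1.sub hb.hasSum
  rw [← hd.tsum_eq, mul_comm, tsum_mul_tsum_eq_tsum_sum_antidiagonal_of_summable_norm
    hd.summable.norm ha.norm]
  have : ∀ n, ∑ kl ∈ Finset.HasAntidiagonal.antidiagonal n, ((if kl.1 = 0 then (1 : ℂ) else 0) -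
      (b kl.1 : ℂ) * t ^ kl.1) * ((a kl.2 : ℂ) * t ^ kl.2) = if n = 0 then (a 0 : ℂ) else 0 := by
    intro n
    have e : ∀ kl ∈ Finset.HasAntidiagonal.antidiagonal n, ((if kl.1 = 0 then (1 : ℂ) else 0) -
        (b kl.1 : ℂ) * t ^ kl.1) * ((a kl.2 : ℂ) * t ^ kl.2) =
        (((((if kl.1 = 0 then 1 else 0) - b kl.1) * a kl.2 : ℝ)) : ℂ) * t ^ n := by
      rintro ⟨k, l⟩ hkl
      rw [Finset.HasAntidiagonal.mem_antidiagonal] at hkl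
      simp only at hkl
      rw [← hkl]
      by_cases hk : k = 0
      · subst hk
        push_cast
        simp
        ring
      · push_cast
        simp [hk]
        ring
    rw [Finset.sum_congr rfl e, ← Finset.sum_mul, ← Complex.ofReal_sum, hconv]
    by_cases hn : n = 0 <;> simp [hn]
  simp_rw [this]
  exact tsum_ite_eq 0 _

theorem theorem9p5 (f : ℝ → ℝ)
    (hf : ContDiffOn ℝ 2 f (Set.Ici 0))
    (hpos : ∀ x ∈ Set.Ici (0 : ℝ), 0 < f x)
    (hlog : ∀ x ∈ Set.Ici (0 : ℝ),
      (derivWithin f (Set.Ici 0) x) ^ 2 ≤ iteratedDerivWithin 2 f (Set.Ici 0) x * f x)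
    (Ω : Set ℂ) (hΩ : IsOpen Ω) (hΩ' : IsConnected Ω)
    (hconv : ∀ z ∈ Ω, ∀ w ∈ Ω,
      Summable fun n : ℕ => (f n : ℂ) * (z ^ n * (starRingEnd ℂ w) ^ n)) :
    IsCNPKernel fun z w : Ω =>
      ∑' n : ℕ, (f n : ℂ) * ((z : ℂ) ^ n * (starRingEnd ℂ (w : ℂ)) ^ n) := by
  set a : ℕ → ℝ := fun n => f n with ha
  have hapos : ∀ n, 0 < a n := fun n => hpos n (Set.mem_Ici.mpr n.cast_nonneg)
  obtain ⟨b, hb, hba, hab⟩ := exists_kaluza_coeff hapos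
    (sq_succ_le_mul_of_log_convex hf hpos hlog)
  have hsa : ∀ z ∈ Ω, Summable fun n => a n * ‖z‖ ^ (2 * n) := by
    intro z hz
    refine (hconv z hz z hz).norm.congr fun n => ?_
    rw [norm_mul, norm_mul, norm_pow, norm_pow, RCLike.norm_conj, Complex.norm_real,
      Real.norm_of_nonneg (hapos n).le]
    ring
  have hbd : ∀ n, b n ≤ (a 0)⁻¹ * a n := fun n => by
    rw [le_inv_mul_iff₀ (hapos 0)]
    exact hba n
  have hsb : ∀ z ∈ Ω, Summable fun n => b n * ‖z‖ ^ (2 * n) := by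
    intro z hz
    refine Summable.of_nonneg_of_le (fun n => mul_nonneg (hb n) (by positivity)) (fun n => ?_)
      ((hsa z hz).mul_left (a 0)⁻¹)
    rw [← mul_assoc]
    exact mul_le_mul_of_nonneg_right (hbd n) (by positivity)
  obtain ⟨φ, hφ⟩ := exists_lp_inner_eq_tsum (fun n => (hapos n).le) hsa
  obtain ⟨e, he⟩ := exists_lp_inner_eq_tsum hb hsb
  set K : Ω → Ω → ℂ := fun z w =>
    ∑' n : ℕ, (f n : ℂ) * ((z : ℂ) ^ n * (starRingEnd ℂ (w : ℂ)) ^ n) with hKdef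
  have hφK : ∀ z w, inner ℂ (φ z) (φ w) = K z w := hφ
  have hK : IsPosDefKernel K := by
    have := posSemidef_of_inner φ
    simp only [hφK] at this
    exact this
  have hKe : ∀ z w, K z w * (1 - inner ℂ (e z) (e w)) = a 0 := by
    intro z w
    have h1 := hconv z z.2 w w.2
    have h2 : Summable fun n : ℕ => (b n : ℂ) * ((z : ℂ) ^ n * (starRingEnd ℂ (w : ℂ)) ^ n) := by
      refine Summable.of_norm_bounded (h1.norm.mul_left (a 0)⁻¹) fun n => ?_
      rw [norm_mul, norm_mul (f n : ℂ), ← mul_assoc, Complex.norm_real, Complex.norm_real,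
        Real.norm_of_nonneg (hb n), Real.norm_of_nonneg (hapos n).le]
      exact mul_le_mul_of_nonneg_right (hbd n) (norm_nonneg _)
    rw [he]
    simp only [hKdef, ← mul_pow] at h1 h2 ⊢
    exact tsum_mul_one_sub_tsum_eq hab h1 h2
  refine isCNPKernel_of_mul_one_sub_inner hK e (fun z => ?_) (hapos 0) hKe
  have h := hKe z z
  rw [← hφK, inner_self_eq_norm_sq_to_K, inner_self_eq_norm_sq_to_K] at h
  have h' : ‖φ z‖ ^ 2 * (1 - ‖e z‖ ^ 2) = a 0 := by
    apply Complex.ofReal_injective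
    rw [← h]
    push_cast
    rfl
  have h0 : 0 < 1 - ‖e z‖ ^ 2 := by
    refine pos_of_mul_pos_right ?_ (sq_nonneg ‖φ z‖)
    rw [h']
    exact hapos 0
  nlinarith [norm_nonneg (e z)]
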